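/- Let $L$ be an oriented link in $\mathbb{R}^3$, i.e. a smoothly embedded finite disjoint union of oriented circles, and let $D$ be a diagram of $L$, i.e. a regular projection of $L$ to a plane (immersed, with finitely many multiple points, all of them transverse double points) together with the over/under information at each crossing. Let $\mathcal{K}(L)$ be the fundamental quandle of $L$: it is generated by the arcs of $D$ (the components of $L$ cut at its undercrossings), with one relation $y \rhd x = z$ for each crossing, where $x$ is the overcrossing arc, $y$ is the undercrossing arc to the right of $x$, and $z$ is the undercrossing arc to the left of $x$. Let $\boldsymbol{\lambda}$ be a finite set of primitive integer partitions (partitions, possibly of different integers, with no part equal to $1$). For $\lambda \in \boldsymbol{\lambda}$ a partition of $m$, let $c^n_\lambda \subseteq \mathfrak{S}_n$ be the conjugacy class of permutations whose cycle type is $\lambda$ with $n-m$ ones added if $n \ge m$, and let $c^n_\lambda = \emptyset$ if $n < m$. Let $c^n_{\boldsymbol{\lambda}} = \bigcup_{\lambda \in \boldsymbol{\lambda}} c^n_\lambda$, a quandle under conjugation, $\sigma \rhd \tau = \tau\sigma\tau^{-1}$. An injection $f : [m] \hookrightarrow [n]$ induces a quandle homomorphism $f_* : c^m_{\boldsymbol{\lambda}}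 \to c^n_{\boldsymbol{\lambda}}$, where $f_*\sigma$ equals $f \circ \sigma \circ f^{-1}$ on the image of $f$ and is the identity elsewhere. Let $\mathrm{FI}$ be the category of the sets $[n] = \{1, \dots, n\}$, $n \ge 0$, and injections, and let $V^{L,\boldsymbol{\lambda}}$ be the FI-module over $\mathbb{Q}$ (functor from $\mathrm{FI}$ to $\mathbb{Q}$-vector spaces) given by $$V^{L,\boldsymbol{\lambda}}_n = \mathbb{Q}\big[\operatorname{Hom}(\mathcal{K}(L), c^n_{\boldsymbol{\lambda}})\big],$$ the vector space with basis the set of quandle homomorphisms, on which an injection $f$ acts by $\varphi \mapsto f_* \circ \varphi$ on basis vectors. Then $V^{L,\boldsymbol{\lambda}}$ is finitely generated: there are $d \ge 0$ and a finite subset of $\bigoplus_{n=0}^{d} V^{L,\boldsymbol{\lambda}}_n$ that is not contained in any proper sub-FI-module of $V^{L,\boldsymbol{\lambda}}$. -/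

import Mathlib

open CategoryTheory Filter Topology
open scoped ContDiff

noncomputable section

/-! # Quandles presented by generators and relations

Mathlib's `Shelf.act x y` (written `x ◃ y`) is the right-handed operation `y ▷ x`: the element `x`
acts on `y`.  In a group under conjugation it is `x * y * x⁻¹`. -/

/-- Formal quandle words in the generators `A`. -/
inductive QuandleWord (A : Type) : Type
  | gen : A → QuandleWord A
  | act : QuandleWord A → QuandleWord A → QuandleWord A
  | invAct : QuandleWord A → QuandleWord A → QuandleWord A

/-- The smallest congruence on words that contains the relations `r` and the quandle axioms. -/
inductive QuandleWord.Equivalent {A : Type} (r : QuandleWord A → QuandleWord A → Prop) :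
    QuandleWord A → QuandleWord A → Prop
  | of {x y} : r x y → Equivalent r x y
  | refl (x) : Equivalent r x x
  | symm {x y} : Equivalent r x y → Equivalent r y x
  | trans {x y z} : Equivalent r x y → Equivalent r y z → Equivalent r x z
  | act_congr {x x' y y'} : Equivalent r x x' → Equivalent r y y' →
      Equivalent r (.act x y) (.act x' y')
  | invAct_congr {x x' y y'} : Equivalent r x x' → Equivalent r y y' →
      Equivalent r (.invAct x y) (.invAct x' y')
  | self_distrib (x y z) :
      Equivalent r (.act x (.act y z)) (.act (.act x y) (.act x z))
  | left_inv (x y) : Equivalent r (.invAct x (.act x y)) y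
  | right_inv (x y) : Equivalent r (.act x (.invAct x y)) y
  | fix (x) : Equivalent r (.act x x) x

/-- The setoid of the congruence generated by `r`. -/
def QuandleWord.setoid {A : Type} (r : QuandleWord A → QuandleWord A → Prop) :
    Setoid (QuandleWord A) where
  r := QuandleWord.Equivalent r
  iseqv := ⟨.refl, .symm, .trans⟩

/-- The quandle with generators `A` and defining relations `r`: the quotient of the free quandle
on `A` by the congruence generated by `r`. -/
def PresentedQuandle {A : Type} (r : QuandleWord A → QuandleWord A → Prop) : Type :=
  Quotient (QuandleWord.setoid r)

instance PresentedQuandle.instQuandle {A : Type} (r : QuandleWord A → QuandleWord A → Prop) :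
    Quandle (PresentedQuandle r) where
  act := Quotient.map₂ QuandleWord.act fun _ _ h _ _ h' => .act_congr h h'
  self_distrib := by
    rintro ⟨x⟩ ⟨y⟩ ⟨z⟩
    exact Quotient.sound (.self_distrib x y z)
  invAct := Quotient.map₂ QuandleWord.invAct fun _ _ h _ _ h' => .invAct_congr h h'
  left_inv := by
    rintro ⟨x⟩ ⟨y⟩
    exact Quotient.sound (.left_inv x y)
  right_inv := by
    rintro ⟨x⟩ ⟨y⟩
    exact Quotient.sound (.right_inv x y)
  fix := by
    rintro ⟨x⟩
    exact Quotient.sound (.fix x)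

/-! # Oriented links, their diagrams and the fundamental quandle -/

/-- An oriented (smooth) link in `ℝ³`: a smooth embedding of a finite disjoint union of circles
`ℝ/ℤ`.  The orientation is the one in which the parameter increases. -/
structure OrientedLink where
  /-- the number of components -/
  components : ℕ
  /-- the parametrized components -/
  curve : Fin components → UnitAddCircle → EuclideanSpace ℝ (Fin 3)
  smooth : ∀ i, ContDiff ℝ ∞ fun t : ℝ => curve i (t : UnitAddCircle)
  immersed : ∀ i (t : ℝ), deriv (fun s : ℝ => curve i (s : UnitAddCircle)) t ≠ 0
  injective : Function.Injective fun p : Fin components × UnitAddCircle => curve p.1 p.2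

namespace OrientedLink

variable (L : OrientedLink)

/-- The points of the link, through its parametrization. -/
abbrev Point : Type := Fin L.components × UnitAddCircle

/-- The point reached from `p` by moving the parameter by `t` along the same component. -/
def shift (p : L.Point) (t : ℝ) : L.Point := (p.1, p.2 + (t : UnitAddCircle))

/-- The position in `ℝ³`. -/
def position (p : L.Point) : EuclideanSpace ℝ (Fin 3) := L.curve p.1 p.2

/-- The tangent vector, in the direction of the orientation. -/
def velocity (p : L.Point) : EuclideanSpace ℝ (Fin 3) :=
  deriv (fun t : ℝ => L.position (L.shift p t)) 0

/-- A diagram of `L`: a positively oriented orthonormal frame such that the projection of `L` to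
the plane of the first two coordinates is regular.  The third coordinate is the height, which
decides which strand of a crossing goes over. -/
structure Diagram where
  /-- the frame: two vectors that span the plane, and the direction of projection -/
  frame : OrthonormalBasis (Fin 3) ℝ (EuclideanSpace ℝ (Fin 3))
  positive : 0 < (EuclideanSpace.basisFun (Fin 3) ℝ).toBasis.det frame
  /-- the projected curves are immersed -/
  immersed : ∀ p : L.Point,
    frame.repr (L.velocity p) 0 ≠ 0 ∨ frame.repr (L.velocity p) 1 ≠ 0
  /-- there are only finitely many multiple points -/
  finite_multiple : {p : L.Point | ∃ q, q ≠ p ∧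
    frame.repr (L.position p) 0 = frame.repr (L.position q) 0 ∧
    frame.repr (L.position p) 1 = frame.repr (L.position q) 1}.Finite
  /-- there are no triple points -/
  no_triple : ∀ p q r : L.Point,
    frame.repr (L.position p) 0 = frame.repr (L.position q) 0 →
    frame.repr (L.position p) 1 = frame.repr (L.position q) 1 →
    frame.repr (L.position p) 0 = frame.repr (L.position r) 0 →
    frame.repr (L.position p) 1 = frame.repr (L.position r) 1 →
    p = q ∨ p = r ∨ q = r
  /-- double points are transverse -/
  transverse : ∀ p q : L.Point, p ≠ q →
    frame.repr (L.position p) 0 = frame.repr (L.position q) 0 →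
    frame.repr (L.position p) 1 = frame.repr (L.position q) 1 →
    frame.repr (L.velocity p) 0 * frame.repr (L.velocity q) 1 -
      frame.repr (L.velocity p) 1 * frame.repr (L.velocity q) 0 ≠ 0

namespace Diagram

variable {L} (D : L.Diagram)

/-- `D.Crosses p q`: the link passes under itself at `p`, and `q` is the point of the
overcrossing strand above `p`. -/
def Crosses (p q : L.Point) : Prop :=
  D.frame.repr (L.position p) 0 = D.frame.repr (L.position q) 0 ∧
  D.frame.repr (L.position p) 1 = D.frame.repr (L.position q) 1 ∧
  D.frame.repr (L.position p) 2 < D.frame.repr (L.position q) 2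

/-- `p` is an undercrossing. -/
def IsUnder (p : L.Point) : Prop := ∃ q, D.Crosses p q

/-- The arcs of the diagram: the connected components of the link cut at its undercrossings. -/
def Arc : Type := ConnectedComponents {p : L.Point // ¬ D.IsUnder p}

/-- The point `p` is not an undercrossing and lies on the arc `a`. -/
def LiesOn (p : L.Point) (a : D.Arc) : Prop :=
  ∃ h : ¬ D.IsUnder p, ConnectedComponents.mk (⟨p, h⟩ : {p : L.Point // ¬ D.IsUnder p}) = a

/-- The arc `a` ends at `p`. -/
def EndsAt (a : D.Arc) (p : L.Point) : Prop := ∀ᶠ t in 𝓝[<] (0 : ℝ), D.LiesOn (L.shift p t) a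

/-- The arc `a` starts at `p`. -/
def StartsAt (a : D.Arc) (p : L.Point) : Prop := ∀ᶠ t in 𝓝[>] (0 : ℝ), D.LiesOn (L.shift p t) a

/-- The oriented area of the parallelogram spanned by the projections of the tangent vectors at
`q` and at `p`.  At a crossing it is positive if the strand through `p` passes from the right
of the strand through `q` to its left. -/
def sign (q p : L.Point) : ℝ :=
  D.frame.repr (L.velocity q) 0 * D.frame.repr (L.velocity p) 1 -
    D.frame.repr (L.velocity q) 1 * D.frame.repr (L.velocity p) 0

/-- The crossing relations: if at a crossing `x` is the overcrossing arc, `y` the undercrossing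
arc to the right of `x` and `z` the undercrossing arc to the left of `x`, then `y ▷ x = z`. -/
inductive Relation : QuandleWord D.Arc → QuandleWord D.Arc → Prop
  | rightToLeft {p q : L.Point} {x y z : D.Arc} (h : D.Crosses p q) (hs : 0 < D.sign q p)
      (hx : D.LiesOn q x) (hy : D.EndsAt y p) (hz : D.StartsAt z p) :
      Relation (.act (.gen x) (.gen y)) (.gen z)
  | leftToRight {p q : L.Point} {x y z : D.Arc} (h : D.Crosses p q) (hs : D.sign q p < 0)
      (hx : D.LiesOn q x) (hy : D.StartsAt y p) (hz : D.EndsAt z p) :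
      Relation (.act (.gen x) (.gen y)) (.gen z)

/-- The fundamental quandle of the link, computed from the diagram `D`: generators are the arcs,
relations are the crossing relations. -/
abbrev FundamentalQuandle : Type := PresentedQuandle D.Relation

end Diagram

end OrientedLink

/-! # Conjugacy classes of symmetric groups -/

/-- An integer partition (of any natural number). -/
abbrev IntPartition : Type := Σ m : ℕ, m.Partition

/-- A partition is primitive if no part equals `1`. -/
def IntPartition.IsPrimitive (l : IntPartition) : Prop := 1 ∉ l.2.parts

/-- The class `c^n_l` of the permutations of `[n]` whose cycle lengths, with fixed points counted
as cycles of length `1`, are the parts of `l` together with `n - m` ones, where `l` is a partition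
of `m`; it is empty if `n < m`. -/
def conjClass (l : IntPartition) (n : ℕ) : Set (Equiv.Perm (Fin n)) :=
  {σ | l.1 ≤ n ∧ σ.partition.parts = l.2.parts + Multiset.replicate (n - l.1) 1}

/-- The union of the classes `c^n_l` over `l ∈ Λ`. -/
def ClassUnion (Λ : Finset IntPartition) (n : ℕ) : Type :=
  {σ : Equiv.Perm (Fin n) // ∃ l ∈ Λ, σ ∈ conjClass l n}

theorem conjClass_conj {l : IntPartition} {n : ℕ} {σ : Equiv.Perm (Fin n)} (τ : Equiv.Perm (Fin n))
    (h : σ ∈ conjClass l n) : τ * σ * τ⁻¹ ∈ conjClass l n := by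
  refine ⟨h.1, ?_⟩
  rw [← h.2, ← Equiv.Perm.partition_eq_of_isConj.1 (isConj_iff.2 ⟨τ, rfl⟩ : IsConj σ _)]

/-- The union of classes as a quandle under conjugation. -/
instance ClassUnion.instQuandle (Λ : Finset IntPartition) (n : ℕ) : Quandle (ClassUnion Λ n) where
  act x y := ⟨x.1 * y.1 * x.1⁻¹, y.2.imp fun _ h => ⟨h.1, conjClass_conj x.1 h.2⟩⟩
  self_distrib := by
    intro x y z
    apply Subtype.ext
    simp [mul_assoc]
  invAct x y := ⟨x.1⁻¹ * y.1 * x.1, y.2.imp fun _ h => ⟨h.1, by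
    simpa using conjClass_conj x.1⁻¹ h.2⟩⟩
  left_inv := by
    intro x y
    apply Subtype.ext
    simp [mul_assoc]
  right_inv := by
    intro x y
    apply Subtype.ext
    simp [mul_assoc]
  fix := by
    intro x
    apply Subtype.ext
    simp

theorem conjClass_viaEmbedding {l : IntPartition} {m n : ℕ} {σ : Equiv.Perm (Fin m)}
    (f : Fin m ↪ Fin n) (h : σ ∈ conjClass l m) : σ.viaEmbedding f ∈ conjClass l n := by
  have hmn : m ≤ n := by simpa using Fintype.card_le_of_embedding f
  refine ⟨h.1.trans hmn, ?_⟩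
  have h2 := h.2
  have hs : σ.support.card ≤ m := by simpa using σ.support.card_le_univ
  have hl := h.1
  rw [Equiv.Perm.parts_partition, Fintype.card_fin] at h2 ⊢
  have e1 : (σ.viaEmbedding f).cycleType = σ.cycleType := by
    classical
    convert Equiv.Perm.cycleType_extendDomain (Equiv.ofInjective f.1 f.2) (g := σ)
    rw [Equiv.Perm.viaEmbedding]
    congr!
  have e2 : (σ.viaEmbedding f).support.card = σ.support.card := by
    rw [← Equiv.Perm.sum_cycleType, ← Equiv.Perm.sum_cycleType, e1]
  rw [e1, e2, show n - σ.support.card = (m - σ.support.card) + (n - m) by omega,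
    show n - l.1 = (m - l.1) + (n - m) by omega, Multiset.replicate_add, Multiset.replicate_add,
    ← add_assoc, ← add_assoc, h2]

/-- The quandle map `f_*` induced by an injection `f : [m] ↪ [n]`: the permutation `f_* σ` is
`f ∘ σ ∘ f⁻¹` on the image of `f` and the identity elsewhere. -/
def ClassUnion.map (Λ : Finset IntPartition) {m n : ℕ} (f : Fin m ↪ Fin n) :
    ShelfHom (ClassUnion Λ m) (ClassUnion Λ n) where
  toFun σ := ⟨σ.1.viaEmbedding f, σ.2.imp fun _ h => ⟨h.1, conjClass_viaEmbedding f h.2⟩⟩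
  map_act' := by
    intro x y
    apply Subtype.ext
    have h := map_mul (Equiv.Perm.viaEmbeddingHom f)
    have h' := map_inv (Equiv.Perm.viaEmbeddingHom f)
    simp only [Equiv.Perm.viaEmbeddingHom_apply] at h h'
    change (x.1 * y.1 * x.1⁻¹).viaEmbedding f = _
    rw [h, h, h']
    rfl

theorem Equiv.Perm.viaEmbedding_refl {n : ℕ} (σ : Equiv.Perm (Fin n)) :
    σ.viaEmbedding (Function.Embedding.refl (Fin n)) = σ := by
  ext i
  simpa using congrArg Fin.val (σ.viaEmbedding_apply (Function.Embedding.refl (Fin n)) i)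

theorem Equiv.Perm.viaEmbedding_trans {l m n : ℕ} (σ : Equiv.Perm (Fin l)) (f : Fin l ↪ Fin m)
    (g : Fin m ↪ Fin n) :
    σ.viaEmbedding (f.trans g) = (σ.viaEmbedding f).viaEmbedding g := by
  ext i
  congr 1
  by_cases hi : ∃ j, g j = i
  · obtain ⟨j, rfl⟩ := hi
    rw [Equiv.Perm.viaEmbedding_apply]
    by_cases hj : ∃ k, f k = j
    · obtain ⟨k, rfl⟩ := hj
      rw [Equiv.Perm.viaEmbedding_apply]
      exact σ.viaEmbedding_apply (f.trans g) k
    · rw [Equiv.Perm.viaEmbedding_apply_of_notMem _ f _ (by simpa using hj),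
        Equiv.Perm.viaEmbedding_apply_of_notMem]
      rintro ⟨k, hk⟩
      exact hj ⟨k, g.injective hk⟩
  · rw [Equiv.Perm.viaEmbedding_apply_of_notMem _ g _ (by simpa using hi),
      Equiv.Perm.viaEmbedding_apply_of_notMem]
    rintro ⟨k, hk⟩
    exact hi ⟨f k, hk⟩

theorem ClassUnion.map_refl (Λ : Finset IntPartition) (n : ℕ) :
    ClassUnion.map Λ (Function.Embedding.refl (Fin n)) = ShelfHom.id _ := by
  ext σ
  exact Subtype.ext σ.1.viaEmbedding_refl

theorem ClassUnion.map_trans (Λ : Finset IntPartition) {l m n : ℕ} (f : Fin l ↪ Fin m)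
    (g : Fin m ↪ Fin n) :
    ClassUnion.map Λ (f.trans g) = (ClassUnion.map Λ g).comp (ClassUnion.map Λ f) := by
  ext σ
  exact Subtype.ext (σ.1.viaEmbedding_trans f g)

/-! # FI-modules -/

/-- The category `FI`: the object `⟨n⟩` is the finite set `[n]`. -/
structure FI where
  /-- the number of elements -/
  card : ℕ

/-- The morphisms of `FI` are the injections. -/
instance FI.instCategory : Category FI where
  Hom m n := Fin m.card ↪ Fin n.card
  id n := Function.Embedding.refl (Fin n.card)
  comp f g := Function.Embedding.trans f g

/-- An FI-module over `k`. -/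
abbrev FIModule (k : Type) [CommRing k] : Type 1 := FI ⥤ ModuleCat.{0} k

namespace FIModule

variable {k : Type} [CommRing k] (V : FIModule k)

/-- A submodule of an FI-module, given by its image: submodules `W_n ⊆ V_n` that are preserved by
the maps induced by injections. -/
structure Sub where
  /-- the submodule in each degree -/
  carrier : ∀ n : FI, Submodule k (V.obj n)
  map_mem : ∀ {m n : FI} (f : m ⟶ n) {v : V.obj m}, v ∈ carrier m → V.map f v ∈ carrier n

/-- `V` is finitely generated in degree at most `d`: some finite subset of the direct sum
`⨁_{n = 0}^{d} V_n` is not contained in any proper submodule of `V`. -/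
def FinitelyGeneratedInDegreeLE (d : ℕ) : Prop :=
  ∃ S : Set (∀ n : Fin (d + 1), V.obj ⟨n⟩), S.Finite ∧
    ∀ W : V.Sub, (∀ v ∈ S, ∀ n : Fin (d + 1), v n ∈ W.carrier ⟨n⟩) → ∀ n, W.carrier n = ⊤

/-- `V` is finitely generated. -/
def FinitelyGenerated : Prop := ∃ d, V.FinitelyGeneratedInDegreeLE d

end FIModule

/-- For a quandle `K`, the rational FI-module whose degree `n` part has the set of quandle
homomorphisms from `K` to the union of the classes `c^n_l`, `l ∈ Λ`, as a basis; an injection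
`f` sends the basis vector `φ` to the basis vector `f_* ∘ φ`. -/
def coloringModule (K : Type) [Quandle K] (Λ : Finset IntPartition) : FIModule ℚ where
  obj n := ModuleCat.of ℚ (ShelfHom K (ClassUnion Λ n.card) →₀ ℚ)
  map f := ModuleCat.ofHom
    (Finsupp.lmapDomain ℚ ℚ fun φ => (ClassUnion.map Λ f).comp φ)
  map_id n := by
    have h : (fun φ : ShelfHom K (ClassUnion Λ n.card) =>
        (ClassUnion.map Λ (Function.Embedding.refl (Fin n.card))).comp φ) = id := by
      funext φ
      rw [ClassUnion.map_refl]
      rfl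
    change ModuleCat.ofHom (Finsupp.lmapDomain ℚ ℚ fun φ : ShelfHom K (ClassUnion Λ n.card) =>
        (ClassUnion.map Λ (Function.Embedding.refl (Fin n.card))).comp φ) = _
    rw [h, Finsupp.lmapDomain_id]
    rfl
  map_comp {a b c} f g := by
    have h : (fun φ : ShelfHom K (ClassUnion Λ a.card) =>
        (ClassUnion.map Λ (Function.Embedding.trans f g)).comp φ) =
        (fun φ => (ClassUnion.map Λ g).comp φ) ∘ fun φ => (ClassUnion.map Λ f).comp φ := by
      funext φ
      rw [ClassUnion.map_trans]
      rfl
    change ModuleCat.ofHom (Finsupp.lmapDomain ℚ ℚ fun φ : ShelfHom K (ClassUnion Λ a.card) =>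
        (ClassUnion.map Λ (Function.Embedding.trans f g)).comp φ) = _
    rw [h, Finsupp.lmapDomain_comp]
    rfl

/-- The FI-module of colorings of an oriented link by the quandles `⋃_{l ∈ Λ} c^n_l`, where the
fundamental quandle of the link is computed from the diagram `D`. -/
def linkModule {L : OrientedLink} (D : L.Diagram) (Λ : Finset IntPartition) : FIModule ℚ :=
  coloringModule D.FundamentalQuandle Λ

end

/-! Only finite generation of the fundamental quandle matters; the crossing relations play no role.
A diagram has finitely many undercrossings, so it has finitely many arcs
(`OrientedLink.Diagram.finite_arc`), and these generate.

A coloring is determined by its values on generators. As no part of a partition `l` of `m` equals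
`1`, every permutation in the class of `l` moves exactly `m` points, whatever `n` is. With `k`
generators, the generator values together move at most `d = k * max m` points. The permutations
supported on a given set of points form a subgroup, so conjugation never leaves that set and the
whole coloring is supported there. It therefore comes from a coloring in degree at most `d`
(`Quandle.GeneratedBy.exists_comp_map`). The basis vectors of degree at most `d`, finite in number
because the target quandles are finite, thus generate the module. -/

noncomputable section

/-! # Finitely many connected components -/

/-- Removing a finite set from a preconnected set of reals leaves a finite union of preconnected
sets. -/
theorem IsPreconnected.exists_finite_cover_diff {I F : Set ℝ} (hI : _root_.IsPreconnected I)
    (hF : F.Finite) :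
    ∃ C : Set (Set ℝ), C.Finite ∧ (∀ s ∈ C, _root_.IsPreconnected s) ∧ ⋃₀ C = I \ F := by
  induction F, hF using Set.Finite.induction_on with
  | empty => exact ⟨{I}, Set.finite_singleton I, by simpa using hI, by simp⟩
  | @insert a F _ _ ih =>
    obtain ⟨C, hC, hconn, hcov⟩ := ih
    -- Each piece is cut at `a` into its parts below and above; on the line, order-connected sets
    -- are preconnected.
    refine ⟨(fun s => s ∩ Set.Iio a) '' C ∪ (fun s => s ∩ Set.Ioi a) '' C,
      (hC.image _).union (hC.image _), ?_, ?_⟩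
    · rintro _ (⟨s, hs, rfl⟩ | ⟨s, hs, rfl⟩)
      · exact ((hconn s hs).ordConnected.inter Set.ordConnected_Iio).isPreconnected
      · exact ((hconn s hs).ordConnected.inter Set.ordConnected_Ioi).isPreconnected
    · rw [← Set.union_singleton, ← Set.sdiff_sdiff, ← hcov]
      ext x
      simp only [Set.mem_sUnion, Set.mem_union, Set.mem_image, Set.mem_sdiff,
        Set.mem_singleton_iff]
      constructor
      · rintro ⟨_, ⟨s, hs, rfl⟩ | ⟨s, hs, rfl⟩, hx⟩
        · exact ⟨⟨s, hs, hx.1⟩, ne_of_lt hx.2⟩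
        · exact ⟨⟨s, hs, hx.1⟩, ne_of_gt hx.2⟩
      · rintro ⟨⟨s, hs, hx⟩, hxa⟩
        rcases lt_or_gt_of_ne hxa with h | h
        · exact ⟨_, .inl ⟨s, hs, rfl⟩, hx, h⟩
        · exact ⟨_, .inr ⟨s, hs, rfl⟩, hx, h⟩

/-- A space covered by finitely many preconnected sets has finitely many connected components. -/
theorem ConnectedComponents.finite_of_cover {X : Type*} [TopologicalSpace X] {C : Set (Set X)}
    (hC : C.Finite) (hconn : ∀ s ∈ C, _root_.IsPreconnected s) (hcov : ∀ x, ∃ s ∈ C, x ∈ s) :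
    Finite (ConnectedComponents X) := by
  choose c hc hxc using hcov
  have : Finite C := hC
  -- Pick a representative of every component and send the component to a piece containing it. A
  -- preconnected piece meets only one component, so this map is injective.
  obtain ⟨r, hr⟩ := (ConnectedComponents.surjective_coe (α := X)).hasRightInverse
  refine Finite.of_injective (fun a => (⟨c (r a), hc (r a)⟩ : C)) fun a b hab => ?_
  have hab' : c (r a) = c (r b) := congrArg Subtype.val hab
  rw [← hr a, ← hr b, ConnectedComponents.coe_eq_coe']
  exact (hconn _ (hc (r b))).subset_connectedComponent (hxc (r b)) (hab' ▸ hxc (r a))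

/-- A finite disjoint union of circles cut at finitely many points has finitely many components. -/
theorem finite_connectedComponents_circles_compl {N : ℕ} {P : Fin N × UnitAddCircle → Prop}
    (hP : {p | P p}.Finite) : Finite (ConnectedComponents {p // ¬ P p}) := by
  let g (i : Fin N) (t : ℝ) : Fin N × UnitAddCircle := (i, (t : UnitAddCircle))
  have hg (i : Fin N) : Continuous (g i) := by
    have : Continuous fun t : ℝ => (t : UnitAddCircle) := AddCircle.continuous_mk' (1 : ℝ)
    exact continuous_const.prodMk this
  -- On the fundamental domain `[0, 1)` the parametrization is injective, so finitely many cut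
  -- points have finitely many parameters.
  have hfin (i : Fin N) : (Set.Ico (0 : ℝ) 1 ∩ g i ⁻¹' {p | P p}).Finite := by
    refine Set.Finite.of_finite_image (f := g i) (hP.subset ?_) ?_
    · rintro _ ⟨t, ht, rfl⟩
      exact ht.2
    · intro s hs t ht hst
      have : ((s : ℝ) : AddCircle (1 : ℝ)) = t := congrArg Prod.snd hst
      have hs' := hs.1
      have ht' := ht.1
      rwa [AddCircle.coe_eq_coe_iff_of_mem_Ico (a := 0) (by simpa using hs')
        (by simpa using ht')] at this
  choose C hC hconn hcov using fun i =>
    (isPreconnected_Ico (a := (0 : ℝ)) (b := 1)).exists_finite_cover_diff (hfin i)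
  refine ConnectedComponents.finite_of_cover
    (C := ⋃ i, (fun s => (Subtype.val ⁻¹' (g i '' s) : Set {p // ¬ P p})) '' C i)
    (Set.finite_iUnion fun i => (hC i).image _) ?_ ?_
  · intro u hu
    obtain ⟨i, s, hs, rfl⟩ := Set.mem_iUnion.1 hu
    have hval : IsInducing (Subtype.val : {p // ¬ P p} → Fin N × UnitAddCircle) := .subtypeVal
    rw [← hval.isPreconnected_image, Set.image_preimage_eq_of_subset]
    · exact (hconn i s hs).image _ (hg i).continuousOn
    · rintro _ ⟨t, ht, rfl⟩
      have : t ∈ ⋃₀ C i := ⟨s, hs, ht⟩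
      rw [hcov] at this
      simpa using fun h => this.2 ⟨this.1, h⟩
  · rintro ⟨⟨i, q⟩, hq⟩
    obtain ⟨t, ht, rfl⟩ : ∃ t ∈ Set.Ico (0 : ℝ) 1, (t : UnitAddCircle) = q := by
      have h := AddCircle.coe_image_Ico_eq (1 : ℝ) 0
      have hq : q ∈ ((↑) : ℝ → UnitAddCircle) '' Set.Ico 0 (0 + 1) := h ▸ Set.mem_univ q
      simpa using hq
    have : t ∈ ⋃₀ C i := by
      rw [hcov]
      exact ⟨ht, fun h => hq h.2⟩
    obtain ⟨s, hs, hts⟩ := this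
    exact ⟨_, Set.mem_iUnion.2 ⟨i, s, hs, rfl⟩, t, hts, rfl⟩

/-- Undercrossings are multiple points of the projection: the strict height inequality forces the
two points over a crossing to differ. -/
theorem OrientedLink.Diagram.finite_arc {L : OrientedLink} (D : L.Diagram) : Finite D.Arc := by
  refine finite_connectedComponents_circles_compl (D.finite_multiple.subset ?_)
  rintro p ⟨q, h0, h1, h2⟩
  refine ⟨q, ?_, h0, h1⟩
  rintro rfl
  exact lt_irrefl _ h2

/-! # Generators of quandles -/

/-- The elements `g i` generate the quandle `K`. -/
def Quandle.GeneratedBy {K ι : Type} [Quandle K] (g : ι → K) : Prop :=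
  ∀ S : Set K, (∀ i, g i ∈ S) → (∀ x ∈ S, ∀ y ∈ S, Shelf.act x y ∈ S) →
    (∀ x ∈ S, ∀ y ∈ S, Rack.invAct x y ∈ S) → ∀ x, x ∈ S

theorem PresentedQuandle.generatedBy {A : Type} (r : QuandleWord A → QuandleWord A → Prop) :
    Quandle.GeneratedBy (K := PresentedQuandle r)
      fun a => Quotient.mk (QuandleWord.setoid r) (.gen a) := by
  rintro S hg ha hi ⟨w⟩
  induction w with
  | gen a => exact hg a
  | act x y hx hy => exact ha _ hx _ hy
  | invAct x y hx hy => exact hi _ hx _ hy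

theorem ShelfHom.map_invAct {K Q : Type} [Rack K] [Rack Q] (φ : ShelfHom K Q) (x y : K) :
    φ (Rack.invAct x y) = Rack.invAct (φ x) (φ y) := by
  rw [← Rack.left_cancel (φ x), ← φ.map_act, Rack.right_inv, Rack.right_inv]

theorem Quandle.GeneratedBy.hom_ext {K Q ι : Type} [Quandle K] [Quandle Q] {g : ι → K}
    (hg : Quandle.GeneratedBy g) {φ ψ : ShelfHom K Q} (h : ∀ i, φ (g i) = ψ (g i)) : φ = ψ := by
  refine DFunLike.ext _ _ (hg {x | φ x = ψ x} h ?_ ?_)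
  · intro x (hx : _ = _) y (hy : _ = _)
    change φ _ = ψ _
    rw [φ.map_act, ψ.map_act, hx, hy]
  · intro x (hx : _ = _) y (hy : _ = _)
    change φ _ = ψ _
    rw [φ.map_invAct, ψ.map_invAct, hx, hy]

instance ClassUnion.instFinite (Λ : Finset IntPartition) (n : ℕ) : Finite (ClassUnion Λ n) :=
  inferInstanceAs (Finite {σ : Equiv.Perm (Fin n) // ∃ l ∈ Λ, σ ∈ conjClass l n})

theorem Quandle.GeneratedBy.finite_hom {K Q ι : Type} [Quandle K] [Quandle Q] [Finite ι]
    [Finite Q] {g : ι → K} (hg : Quandle.GeneratedBy g) : Finite (ShelfHom K Q) :=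
  Finite.of_injective (fun (φ : ShelfHom K Q) i => φ (g i)) fun _ _ h =>
    hg.hom_ext fun i => congrFun h i

/-! # Permutations supported on the image of an injection -/

/-- Neither `cycleType` nor a primitive partition contains a `1`, so discarding the ones removes
exactly the padding on both sides. Conversely, the cycle type determines the size of the support,
hence both the number of ones and the bound `l.1 ≤ n`. -/
theorem mem_conjClass_iff_cycleType {l : IntPartition} (hl : l.IsPrimitive) {n : ℕ}
    {σ : Equiv.Perm (Fin n)} : σ ∈ conjClass l n ↔ σ.cycleType = l.2.parts := by
  have hcard (h : σ.cycleType = l.2.parts) : σ.support.card = l.1 := by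
    rw [← Equiv.Perm.sum_cycleType, h, l.2.parts_sum]
  have h1 : ∀ (k : ℕ), (Multiset.replicate k 1).filter (· ≠ 1) = 0 := fun k =>
    Multiset.filter_eq_nil.2 fun a ha => by simpa using Multiset.eq_of_mem_replicate ha
  constructor
  · rintro ⟨_, h⟩
    rw [Equiv.Perm.parts_partition] at h
    have h := congrArg (Multiset.filter (· ≠ 1)) h
    rw [Multiset.filter_add, Multiset.filter_add, h1, h1, add_zero, add_zero,
      Multiset.filter_eq_self.2, Multiset.filter_eq_self.2] at h
    · exact h
    · rintro a ha rfl
      exact hl ha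
    · intro a ha
      have := Equiv.Perm.two_le_of_mem_cycleType ha
      omega
  · intro h
    have hs := σ.support.card_le_univ
    rw [Fintype.card_fin] at hs
    refine ⟨hcard h ▸ hs, ?_⟩
    rw [Equiv.Perm.parts_partition, h, hcard h, Fintype.card_fin]

theorem Equiv.Perm.cycleType_viaEmbedding {m n : ℕ} (σ : Equiv.Perm (Fin m))
    (f : Fin m ↪ Fin n) : (σ.viaEmbedding f).cycleType = σ.cycleType := by
  classical
  convert Equiv.Perm.cycleType_extendDomain (Equiv.ofInjective f.1 f.2) (g := σ)
  rw [Equiv.Perm.viaEmbedding]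
  congr!

theorem Equiv.Perm.mem_range_viaEmbeddingHom {m n : ℕ} (f : Fin m ↪ Fin n)
    {σ : Equiv.Perm (Fin n)} (h : ∀ i, σ i ≠ i → i ∈ Set.range f) :
    σ ∈ (Equiv.Perm.viaEmbeddingHom f).range := by
  -- The image of a moved point is again moved, so `σ` restricts to the range of `f`.
  have hσ (i : Fin n) : σ i ∈ Set.range f ↔ i ∈ Set.range f := by
    by_cases hi : σ i = i
    · rw [hi]
    · exact iff_of_true (h _ fun h' => hi (σ.injective h')) (h i hi)
  refine ⟨(Equiv.ofInjective f f.injective).symm.permCongr (σ.subtypePerm hσ), ?_⟩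
  rw [Equiv.Perm.viaEmbeddingHom_apply]
  ext i
  congr 1
  by_cases hi : i ∈ Set.range f
  · obtain ⟨j, rfl⟩ := hi
    rw [Equiv.Perm.viaEmbedding_apply]
    simp [Equiv.permCongr_apply, Equiv.apply_ofInjective_symm]
  · rw [Equiv.Perm.viaEmbedding_apply_of_notMem _ _ _ hi]
    by_contra h'
    exact hi (h i fun h'' => h' h''.symm)

/-! # Factoring colorings -/

theorem ClassUnion.map_injective (Λ : Finset IntPartition) {m n : ℕ} (f : Fin m ↪ Fin n) :
    Function.Injective (ClassUnion.map Λ f) := fun _ _ h =>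
  Subtype.ext (Equiv.Perm.viaEmbeddingHom_injective f (congrArg Subtype.val h))

/-- For primitive partitions, class membership depends only on the cycle type, which does not see
the ambient set; the preimage permutation is therefore in the class of the same partition. -/
theorem ClassUnion.mem_range_map {Λ : Finset IntPartition} (hΛ : ∀ l ∈ Λ, l.IsPrimitive)
    {m n : ℕ} (f : Fin m ↪ Fin n) {σ : ClassUnion Λ n}
    (hσ : σ.1 ∈ (Equiv.Perm.viaEmbeddingHom f).range) : ∃ τ, ClassUnion.map Λ f τ = σ := by
  obtain ⟨τ, hτ⟩ := hσ
  rw [Equiv.Perm.viaEmbeddingHom_apply] at hτ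
  obtain ⟨l, hl, h⟩ := σ.2
  refine ⟨⟨τ, l, hl, ?_⟩, Subtype.ext hτ⟩
  rw [mem_conjClass_iff_cycleType (hΛ l hl)] at h ⊢
  rw [← h, ← hτ, Equiv.Perm.cycleType_viaEmbedding]

/-- A coloring whose values on generators are supported on the image of `f` factors through
`f_*`. -/
theorem Quandle.GeneratedBy.exists_comp_map {K ι : Type} [Quandle K] {g : ι → K}
    (hg : Quandle.GeneratedBy g) {Λ : Finset IntPartition} (hΛ : ∀ l ∈ Λ, l.IsPrimitive)
    {m n : ℕ} (f : Fin m ↪ Fin n) (φ : ShelfHom K (ClassUnion Λ n))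
    (h : ∀ i j, (φ (g i)).1 j ≠ j → j ∈ Set.range f) :
    ∃ ψ : ShelfHom K (ClassUnion Λ m), (ClassUnion.map Λ f).comp ψ = φ := by
  -- The range is a subgroup, hence closed under both quandle operations, so checking generators
  -- suffices.
  have key : ∀ x, (φ x).1 ∈ (Equiv.Perm.viaEmbeddingHom f).range := by
    refine hg {x | (φ x).1 ∈ (Equiv.Perm.viaEmbeddingHom f).range} ?_ ?_ ?_
    · exact fun i => Equiv.Perm.mem_range_viaEmbeddingHom f (h i)
    · intro x hx y hy
      rw [Set.mem_ofPred_eq, φ.map_act]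
      exact mul_mem (mul_mem hx hy) (inv_mem hx)
    · intro x hx y hy
      rw [Set.mem_ofPred_eq, φ.map_invAct]
      exact mul_mem (mul_mem (inv_mem hx) hy) hx
  choose ψ hψ using fun x => ClassUnion.mem_range_map hΛ f (key x)
  -- The pointwise lifts respect the operation because `f_*` is injective.
  refine ⟨⟨ψ, fun {x y} => ClassUnion.map_injective Λ f ?_⟩, DFunLike.ext _ _ hψ⟩
  rw [hψ, φ.map_act, (ClassUnion.map Λ f).map_act, hψ, hψ]

/-- The coloring module of a finitely generated quandle is finitely generated. -/
theorem coloringModule_finitelyGenerated {K ι : Type} [Quandle K] [Finite ι] {g : ι → K}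
    (hg : Quandle.GeneratedBy g) {Λ : Finset IntPartition} (hΛ : ∀ l ∈ Λ, l.IsPrimitive) :
    (coloringModule K Λ).FinitelyGenerated := by
  classical
  have := Fintype.ofFinite ι
  have hfin (n : ℕ) : Finite (ShelfHom K (ClassUnion Λ n)) := hg.finite_hom
  let d := Fintype.card ι * Λ.sup Sigma.fst
  let e (n : Fin (d + 1)) (φ : ShelfHom K (ClassUnion Λ n)) :
      ∀ n : Fin (d + 1), (coloringModule K Λ).obj ⟨n⟩ :=
    Pi.single n (Finsupp.single φ (1 : ℚ) : ShelfHom K (ClassUnion Λ n) →₀ ℚ)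
  refine ⟨d, Set.range fun p : Σ n : Fin (d + 1), ShelfHom K (ClassUnion Λ n) => e p.1 p.2,
    Set.finite_range _, fun W hW n => ?_⟩
  have hlow (m : ℕ) (hm : m ≤ d) (ψ : ShelfHom K (ClassUnion Λ m)) :
      (Finsupp.single ψ (1 : ℚ) : ShelfHom K (ClassUnion Λ m) →₀ ℚ) ∈ W.carrier ⟨m⟩ := by
    let i : Fin (d + 1) := ⟨m, Nat.lt_succ_of_le hm⟩
    have hsingle : e i ψ i = (Finsupp.single ψ (1 : ℚ) : ShelfHom K (ClassUnion Λ m) →₀ ℚ) :=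
      Pi.single_eq_same (M := fun n : Fin (d + 1) => (coloringModule K Λ).obj ⟨n⟩) i _
    exact hsingle ▸ hW _ ⟨⟨i, ψ⟩, rfl⟩ i
  have hbasis (φ : ShelfHom K (ClassUnion Λ n.card)) :
      (Finsupp.single φ (1 : ℚ) : ShelfHom K (ClassUnion Λ n.card) →₀ ℚ) ∈ W.carrier n := by
    -- All points moved by some generator value; each support has the size of a partition in `Λ`,
    -- which gives the bound `d`. The increasing enumeration of `T` then serves as the injection.
    let T : Finset (Fin n.card) := Finset.univ.biUnion fun i => (φ (g i)).1.support
    have hT : T.card ≤ d := by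
      refine Finset.card_biUnion_le_card_mul _ _ _ fun i _ => ?_
      obtain ⟨l, hl, h⟩ := (φ (g i)).2
      rw [mem_conjClass_iff_cycleType (hΛ l hl)] at h
      rw [← Equiv.Perm.sum_cycleType, h, l.2.parts_sum]
      exact Finset.le_sup (f := Sigma.fst) hl
    let f : Fin T.card ↪ Fin n.card := (T.orderEmbOfFin rfl).toEmbedding
    obtain ⟨ψ, hψ⟩ := hg.exists_comp_map hΛ f φ fun i j hj => by
      have hjT : j ∈ (T : Set (Fin n.card)) := by
        simpa [T] using ⟨i, hj⟩
      rw [← Finset.range_orderEmbOfFin T rfl] at hjT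
      exact hjT
    have hmem := W.map_mem (m := ⟨T.card⟩) (n := n) f (hlow T.card hT ψ)
    have hmap : (coloringModule K Λ).map (X := ⟨T.card⟩) (Y := n) f
        (Finsupp.single ψ (1 : ℚ) : ShelfHom K (ClassUnion Λ T.card) →₀ ℚ) =
        (Finsupp.single φ (1 : ℚ) : ShelfHom K (ClassUnion Λ n.card) →₀ ℚ) := by
      refine (Finsupp.mapDomain_single (f := fun ψ => (ClassUnion.map Λ f).comp ψ)).trans ?_
      rw [hψ]
    rwa [hmap] at hmem
  rw [eq_top_iff]
  intro v _
  change ShelfHom K (ClassUnion Λ n.card) →₀ ℚ at v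
  induction v using Finsupp.induction_linear with
  | zero => exact zero_mem _
  | add v w hv hw => exact add_mem (hv trivial) (hw trivial)
  | single φ a =>
    have := (W.carrier n).smul_mem a (hbasis φ)
    have h : a • (Finsupp.single φ (1 : ℚ) : ShelfHom K (ClassUnion Λ n.card) →₀ ℚ) =
        Finsupp.single φ a := by simp
    exact h ▸ this

end

theorem proposition3p4 (L : OrientedLink) (D : L.Diagram) (Λ : Finset IntPartition)
    (hΛ : ∀ l ∈ Λ, IntPartition.IsPrimitive l) :
    (linkModule D Λ).FinitelyGenerated := by
  have := D.finite_arc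
  exact coloringModule_finitelyGenerated (PresentedQuandle.generatedBy D.Relation) hΛ
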